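/- Definitions. Let $\mathbb G=\mathbb R$ or $\mathbb Z$. A set $S\subset\mathbb G$ is relatively dense if for some $l\in\mathbb G$, $l>0$, one has $[a,a+l]\cap S\ne\emptyset$ for all $a\in\mathbb G$. A continuous $f:\mathbb G\to\mathbb R$ is Bohr almost periodic (for $\mathbb G=\mathbb Z$: an almost periodic sequence) if for each $\epsilon>0$ the set $\{r\in\mathbb G:|f(t+r)-f(t)|<\epsilon\ \forall t\in\mathbb G\}$ is relatively dense. A sequence $\{\tau_j\}_{j\in\mathbb Z}\subset\mathbb R$ is admissible if $\tau_j<\tau_{j+1}$ for all $j$ and $\lim_{j\to\pm\infty}\tau_j=\pm\infty$; with $\tau_j^k:=\tau_{j+k}-\tau_j$, the family $\{\{\tau_j^k\}_{j\in\mathbb Z}\}_{k\in\mathbb Z}$ is equi-potentially almost periodic if for each $\epsilon>0$ the set $\{p\in\mathbb Z:|\tau_{j+p}^k-\tau_j^k|<\epsilon\ \forall j,k\in\mathbb Z\}$ is relatively dense. A Wexler sequence is an admissible sequence for which this holds and $\inf_j\tau_j^1>0$. A function $h:\mathbb R\to\mathbb R$ is piecewise continuous if its discontinuities are of the first kind and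 lie in some admissible sequence, at whose points $h$ is continuous from the left. Such an $h$ is piecewise continuous almost periodic (p.c.a.p.) if there is an admissible sequence $\{\sigma_j\}_{j\in\mathbb Z}$ containing all discontinuities of $h$ such that (a) the family $\{\{\sigma_j^k\}\}$ is equi-potentially almost periodic; (b) for each $\epsilon>0$ there is a $\delta>0$ such that $|h(s)-h(t)|<\epsilon$ whenever $s,t\in(\sigma_j,\sigma_{j+1}]$ for some $j$ and $|s-t|<\delta$; (c) for each $\epsilon>0$ the set of all $r\in\mathbb R$ with $|h(t+r)-h(t)|<\epsilon$ for all $t$ satisfying $|t-\sigma_j|>\epsilon$ for all $j\in\mathbb Z$ is relatively dense. Theorem. Let $g_1,\dots,g_d:\mathbb R^d\times\mathbb R\to\mathbb R$ be continuous, let $\{\tau_n\}_{n\in\mathbb Z}$ be a Wexler sequence, and suppose that for $i=1,\dots,d$ the real sequence $b_i=\{b_i(n)\}_{n\in\mathbb Z}$ is almost periodic, $\inf_{n\in\mathbb Z}|1+b_i(n)|>0$, and the equation $x(n)=[1+b_i(n)]x(n-1)$, $n\in\mathbb Z$, has a bounded solution $v_i$ with $\inf_{n\in\mathbb Z}|v_i(n)|>0$.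 Put $$u_i(n)=\prod_{k=1}^n[1+b_i(k)]\ (n>0),\qquad u_i(0)=1,\qquad u_i(n)=\prod_{k=n+1}^0\frac1{1+b_i(k)}\ (n<0),$$ and $\psi_i(t)=u_i(n)$ for $\tau_n<t\le\tau_{n+1}$, $n\in\mathbb Z$. Consider the impulsive system $$y_i'=g_i(y_1,\dots,y_d,t),\ t\ne\tau_n;\qquad y_i(\tau_n^+)=[1+b_i(n)]y_i(\tau_n),\ n\in\mathbb Z,\ i=1,\dots,d,\tag{1}$$ whose solutions are continuous from the left at each $\tau_n$, and the system $$y_i'=\frac{g_i(\psi_1(t)y_1,\dots,\psi_d(t)y_d,t)}{\psi_i(t)},\quad t\ne\tau_n,\ n\in\mathbb Z,\ i=1,\dots,d,\tag{2}$$ whose solutions are continuous on $\mathbb R$. (i) If $(\phi_1,\dots,\phi_d)$ is a solution of (1), every $\phi_i$ is p.c.a.p., and $\phi_i(\tau_n)\ne0$ for all $n\in\mathbb Z$ and $i=1,\dots,d$, then $(\phi_1/\psi_1,\dots,\phi_d/\psi_d)$ is a solution of (2) and every $\phi_i/\psi_i$ is Bohr almost periodic. (ii) Conversely, for functions $\phi_1,\dots,\phi_d:\mathbb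 R\to\mathbb R$, if $(\phi_1/\psi_1,\dots,\phi_d/\psi_d)$ is a solution of (2) and every $\phi_i/\psi_i$ is Bohr almost periodic, then $(\phi_1,\dots,\phi_d)$ is a solution of (1) and every $\phi_i$ is p.c.a.p. -/

import Mathlib

open Set Filter Topology

namespace ImpulsiveAP

/-- A subset `S` of `G` (here `G` is `ℝ` or `ℤ`) is relatively dense if for some `l > 0` every
interval `[a, a + l]` meets `S`. -/
def RelativelyDense {G : Type*} [AddCommGroup G] [LinearOrder G] (S : Set G) : Prop :=
  ∃ l : G, 0 < l ∧ ∀ a : G, (Icc a (a + l) ∩ S).Nonempty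

/-- Bohr almost periodic functions `f : G → ℝ`, for `G = ℝ` or `G = ℤ` (for `ℤ`, with its discrete
topology, the continuity is automatic and these are the almost periodic sequences). -/
def BohrAP {G : Type*} [AddCommGroup G] [LinearOrder G] [TopologicalSpace G] (f : G → ℝ) : Prop :=
  Continuous f ∧ ∀ ε : ℝ, 0 < ε → RelativelyDense {r : G | ∀ t : G, |f (t + r) - f t| < ε}

/-- Admissible sequences: strictly increasing two-sided real sequences tending to `±∞` at `±∞`. -/
def Admissible (τ : ℤ → ℝ) : Prop :=
  (∀ j, τ j < τ (j + 1)) ∧ Tendsto τ atTop atTop ∧ Tendsto τ atBot atBot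

/-- The family of sequences `(τ (j + k) - τ j)_j`, `k ∈ ℤ`, is equi-potentially almost periodic. -/
def EquipotentiallyAP (τ : ℤ → ℝ) : Prop :=
  ∀ ε : ℝ, 0 < ε → RelativelyDense
    {p : ℤ | ∀ j k : ℤ, |(τ (j + p + k) - τ (j + p)) - (τ (j + k) - τ j)| < ε}

/-- Wexler sequences. -/
def IsWexler (τ : ℤ → ℝ) : Prop :=
  Admissible τ ∧ 0 < (⨅ j : ℤ, (τ (j + 1) - τ j)) ∧ EquipotentiallyAP τ

/-- `h` has discontinuities, of the first kind, only at points of the sequence `τ`, and is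
continuous from the left at these points. -/
def IsPCAlong (τ : ℤ → ℝ) (h : ℝ → ℝ) : Prop :=
  (∀ t, t ∉ range τ → ContinuousAt h t) ∧
  ∀ j, ContinuousWithinAt h (Iic (τ j)) (τ j) ∧ ∃ L : ℝ, Tendsto h (𝓝[>] (τ j)) (𝓝 L)

/-- The class `PC(ℝ, ℝ)` of piecewise continuous functions. -/
def IsPC (h : ℝ → ℝ) : Prop := ∃ τ : ℤ → ℝ, Admissible τ ∧ IsPCAlong τ h

/-- Piecewise continuous almost periodic (p.c.a.p.) functions. -/
def IsPCAP (h : ℝ → ℝ) : Prop :=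
  IsPC h ∧ ∃ τ : ℤ → ℝ,
    Admissible τ ∧ (∀ t, t ∉ range τ → ContinuousAt h t) ∧ EquipotentiallyAP τ ∧
    (∀ ε : ℝ, 0 < ε → ∃ δ : ℝ, 0 < δ ∧ ∀ j : ℤ, ∀ s ∈ Ioc (τ j) (τ (j + 1)),
      ∀ t ∈ Ioc (τ j) (τ (j + 1)), |s - t| < δ → |h s - h t| < ε) ∧
    (∀ ε : ℝ, 0 < ε → RelativelyDense
      {r : ℝ | ∀ t : ℝ, (∀ j : ℤ, ε < |t - τ j|) → |h (t + r) - h t| < ε})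

/-- The solution of `x n = (1 + b n) * x (n - 1)`, `n ∈ ℤ`, with `x 0 = 1`. -/
noncomputable def multSeq (b : ℤ → ℝ) (n : ℤ) : ℝ :=
  if 0 ≤ n then ∏ k ∈ Finset.Icc 1 n, (1 + b k) else ∏ k ∈ Finset.Icc (n + 1) 0, 1 / (1 + b k)

/-- The step function equal to `multSeq b n` on `(τ n, τ (n + 1)]`; see `stepFun_eq`. -/
noncomputable def stepFun (τ : ℤ → ℝ) (b : ℤ → ℝ) (t : ℝ) : ℝ :=
  multSeq b (sSup {n : ℤ | τ n < t})

theorem stepFun_eq {τ : ℤ → ℝ} (hτ : Admissible τ) (b : ℤ → ℝ) {t : ℝ} {n : ℤ}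
    (h1 : τ n < t) (h2 : t ≤ τ (n + 1)) : stepFun τ b t = multSeq b n := by
  have hmono : StrictMono τ := strictMono_int_of_lt_succ hτ.1
  have hset : {m : ℤ | τ m < t} = Iic n := by
    ext m
    simp only [mem_ofPred_eq, mem_Iic]
    constructor
    · intro hm
      exact Int.lt_add_one_iff.mp (hmono.lt_iff_lt.mp (hm.trans_le h2))
    · intro hm
      exact (hmono.monotone hm).trans_lt h1
  rw [stepFun, hset, csSup_Iic]

/-- The conditions on one coefficient sequence `b`: it is almost periodic, `inf |1 + b n| > 0`, and
`x n = (1 + b n) * x (n - 1)` has a bounded solution bounded away from zero. -/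
def Regular (b : ℤ → ℝ) : Prop :=
  BohrAP b ∧ 0 < (⨅ n : ℤ, |1 + b n|) ∧
  ∃ v : ℤ → ℝ, (∀ n, v n = (1 + b n) * v (n - 1)) ∧ (∃ M : ℝ, ∀ n, |v n| ≤ M) ∧
    0 < (⨅ n : ℤ, |v n|)

/-- `y` solves `y_i' = g_i (y_1, …, y_d, t)` for `t ≠ τ n`, with the impulses
`y_i (τ n ^+) = (1 + b_i n) * y_i (τ n)`; as usual `y` is continuous from the left at each `τ n`. -/
def IsImpulsiveSolution {d : ℕ} (g : Fin d → (Fin d → ℝ) → ℝ → ℝ) (τ : ℤ → ℝ)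
    (b : Fin d → ℤ → ℝ) (y : Fin d → ℝ → ℝ) : Prop :=
  ∀ i, (∀ t, t ∉ range τ → HasDerivAt (y i) (g i (fun j => y j t) t) t) ∧
    ∀ n, ContinuousWithinAt (y i) (Iic (τ n)) (τ n) ∧
      Tendsto (y i) (𝓝[>] (τ n)) (𝓝 ((1 + b i n) * y i (τ n)))

/-- `y` is a continuous solution of
`y_i' = g_i (ψ_1 t * y_1, …, ψ_d t * y_d, t) / ψ_i t`, `t ≠ τ n`, with `ψ_i = stepFun τ b_i`. -/
def IsTransformedSolution {d : ℕ} (g : Fin d → (Fin d → ℝ) → ℝ → ℝ) (τ : ℤ → ℝ)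
    (b : Fin d → ℤ → ℝ) (y : Fin d → ℝ → ℝ) : Prop :=
  ∀ i, Continuous (y i) ∧ ∀ t, t ∉ range τ →
    HasDerivAt (y i) (g i (fun j => stepFun τ (b j) t * y j t) t / stepFun τ (b i) t) t

end ImpulsiveAP

open ImpulsiveAP

namespace ImpulsiveAP

/-! Crossing `τ n` multiplies both φ_i and ψ_i by 1 + b_i(n), so φ_i/ψ_i has no jump, and ψ_i is
constant between the `τ n`. This makes the two systems equivalent; the rest concerns almost
periodicity.

The sequence u = `multSeq b` is almost periodic. It equals v / v(0), so |u| is bounded and bounded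
away from zero, and log|u| is a bounded sum of the almost periodic sequence log|1 + b|; the
Bohl–Bohr argument (`exists_almostPeriods_sum`) applies. Doubling an almost period restores the
signs (`multSeq_mul_pos`). Hence ψ_i is p.c.a.p. along `τ`.

In (i), φ_i is p.c.a.p. along a sequence σ that need not be related to `τ`. Common almost periods of
φ_i and ψ_i are therefore sought in a weaker sense: the deviation is small outside a set of small
measure in each unit interval (`meanPeriods`). Such periods are stable under sums and negation and
fill a neighbourhood of 0, and two families of this kind have relatively dense intersections
(`IsPeriodFamily.relativelyDense_inter`). A common period almost preserves the quotient off a set of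
small measure, and uniform continuity of the quotient extends this to every point
(`PCAPAlong.bohrAP_div`). In (ii) the same intersection lemma is applied to the quotient and to
`stepPeriods`, the real shifts matched with index shifts. -/

/-! ### Common almost periods of two families. -/

/-- A family of sets of `ε`-almost periods, in the abstract. -/
structure IsPeriodFamily {G : Type*} [AddCommGroup G] [LinearOrder G] [TopologicalSpace G]
    (A : ℝ → Set G) : Prop where
  neg_mem : ∀ ε r, r ∈ A ε → -r ∈ A ε
  add_mem : ∀ ε δ, 0 < ε → 0 < δ → ∀ r s, r ∈ A ε → s ∈ A δ → r + s ∈ A (ε + δ)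
  mem_nhds : ∀ ε, 0 < ε → A ε ∈ 𝓝 0
  dense : ∀ ε, 0 < ε → RelativelyDense (A ε)

theorem RelativelyDense.mono {G : Type*} [AddCommGroup G] [LinearOrder G] {S T : Set G}
    (hS : RelativelyDense S) (h : S ⊆ T) : RelativelyDense T := by
  obtain ⟨l, hl, H⟩ := hS
  exact ⟨l, hl, fun a => (H a).mono (inter_subset_inter_right _ h)⟩

theorem IsPeriodFamily.sub_mem {G : Type*} [AddCommGroup G] [LinearOrder G] [TopologicalSpace G]
    {A : ℝ → Set G} (hA : IsPeriodFamily A) {ε : ℝ} (hε : 0 < ε) {r s : G}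
    (hr : r ∈ A (ε / 2)) (hs : s ∈ A (ε / 2)) : r - s ∈ A ε := by
  have := hA.add_mem _ _ (half_pos hε) (half_pos hε) _ _ hr (hA.neg_mem _ _ hs)
  rwa [add_halves, ← sub_eq_add_neg] at this

/-- Two families of almost periods have common almost periods. -/
theorem IsPeriodFamily.relativelyDense_inter {G : Type*} [AddCommGroup G] [LinearOrder G]
    [TopologicalSpace G] [IsOrderedAddMonoid G] [IsTopologicalAddGroup G] [CompactIccSpace G]
    {A B : ℝ → Set G} (hA : IsPeriodFamily A) (hB : IsPeriodFamily B) {ε : ℝ} (hε : 0 < ε) :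
    RelativelyDense (A ε ∩ B ε) := by
  obtain ⟨l, hl, Hl⟩ := hA.dense (ε / 2) (by positivity)
  obtain ⟨m, hm, Hm⟩ := hB.dense (ε / 3) (by positivity)
  have hη : 0 < ε / 3 := by positivity
  -- Below, `r` and `s` are taken from windows with the same left end, so `r - s` stays in the
  -- compact set `[-m, l]`, covered by finitely many small translates.
  obtain ⟨T, -, hT⟩ := (isCompact_Icc (a := -m) (b := l)).elim_nhds_subcover
    (fun c => {y | y - c ∈ B (ε / 3 / 2)}) (fun c _ => by
      have h1 : Tendsto (fun y : G => y - c) (𝓝 c) (𝓝 0) := by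
        have := (continuous_sub_right c).tendsto c
        rwa [sub_self] at this
      exact h1 (hB.mem_nhds _ (half_pos hη)))
  -- One reference pair per centre `c`. If `(r, s)` and `q c` have nearly equal differences, `r - (q
  -- c).1` is a period for `A` directly, and for `B` because it is `s - (q c).2` plus a small
  -- period.
  have hrep : ∀ c : G, ∃ q : G × G,
      (∃ r s, r ∈ A (ε / 2) ∧ s ∈ B (ε / 3) ∧ r - s - c ∈ B (ε / 3 / 2)) →
      q.1 ∈ A (ε / 2) ∧ q.2 ∈ B (ε / 3) ∧ q.1 - q.2 - c ∈ B (ε / 3 / 2) := by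
    intro c
    by_cases h : ∃ r s, r ∈ A (ε / 2) ∧ s ∈ B (ε / 3) ∧ r - s - c ∈ B (ε / 3 / 2)
    · obtain ⟨r, s, h⟩ := h
      exact ⟨(r, s), fun _ => h⟩
    · exact ⟨(0, 0), fun h' => absurd h' h⟩
  choose q hq using hrep
  obtain ⟨M, hM⟩ := (T.image fun c => |(q c).1|).exists_le
  -- Bounds the finitely many `(q c).1` that matter; starting the windows at `a + K` keeps `r - (q
  -- c).1` above `a`.
  set K := max M 0 with hK
  have hK0 : 0 ≤ K := le_max_right _ _
  refine ⟨l + (K + K), by positivity, fun a => ?_⟩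
  obtain ⟨r, hr, hrA⟩ := Hl (a + K)
  obtain ⟨s, hs, hsB⟩ := Hm (a + K)
  have hrs : r - s ∈ Icc (-m) l := by
    constructor
    · have := sub_le_sub hr.1 hs.2
      simpa [sub_add_eq_sub_sub] using this
    · have := sub_le_sub hr.2 hs.1
      simpa using this
  obtain ⟨c, hcT, hc⟩ := mem_iUnion₂.1 (hT hrs)
  obtain ⟨h1, h2, h3⟩ := hq c ⟨r, s, hrA, hsB, hc⟩
  have hbd : |(q c).1| ≤ K := (hM _ (Finset.mem_image_of_mem _ hcT)).trans (le_max_left _ _)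
  rw [abs_le] at hbd
  refine ⟨r - (q c).1, ⟨?_, ?_⟩, hA.sub_mem hε hrA h1, ?_⟩
  · exact le_sub_iff_add_le.2 ((add_le_add_right hbd.2 a).trans hr.1)
  · have := sub_le_sub hr.2 hbd.1
    calc r - (q c).1 ≤ a + K + l - -K := this
      _ = a + (l + (K + K)) := by abel
  · have h4 : (r - s - c) - ((q c).1 - (q c).2 - c) ∈ B (ε / 3) := hB.sub_mem hη hc h3
    have h5 := hB.add_mem _ _ hη hη _ _ hsB (hB.neg_mem _ _ h2)
    have h6 := hB.add_mem _ _ (add_pos hη hη) hη _ _ h5 h4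
    have e1 : s + -(q c).2 + (r - s - c - ((q c).1 - (q c).2 - c)) = r - (q c).1 := by abel
    have e2 : ε / 3 + ε / 3 + ε / 3 = ε := by ring
    rwa [e1, e2] at h6

/-! ### Bohr almost periodic functions and sequences. -/

/-- The `ε`-almost periods of `f`. -/
def almostPeriods {G : Type*} [AddCommGroup G] (f : G → ℝ) (ε : ℝ) : Set G :=
  {r | ∀ t, |f (t + r) - f t| < ε}

theorem neg_mem_almostPeriods {G : Type*} [AddCommGroup G] {f : G → ℝ} {ε : ℝ} {r : G}
    (hr : r ∈ almostPeriods f ε) : -r ∈ almostPeriods f ε := fun t => by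
  have := hr (t + -r)
  rwa [neg_add_cancel_right, abs_sub_comm] at this

theorem add_mem_almostPeriods {G : Type*} [AddCommGroup G] {f : G → ℝ} {ε δ : ℝ} {r s : G}
    (hr : r ∈ almostPeriods f ε) (hs : s ∈ almostPeriods f δ) :
    r + s ∈ almostPeriods f (ε + δ) := fun t => by
  have h1 := hr t
  have h2 := hs (t + r)
  rw [← add_assoc]
  rw [abs_lt] at *
  constructor <;> linarith [h1.1, h1.2, h2.1, h2.2]

theorem BohrAP.isPeriodFamily_int {f : ℤ → ℝ} (hf : BohrAP f) :
    IsPeriodFamily (almostPeriods f) where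
  neg_mem _ _ := neg_mem_almostPeriods
  add_mem _ _ _ _ _ _ := add_mem_almostPeriods
  mem_nhds ε hε := by
    rw [nhds_discrete, mem_pure]
    intro t
    simpa using hε
  dense := hf.2

theorem BohrAP.exists_bound {f : ℝ → ℝ} (hf : BohrAP f) : ∃ C, 0 < C ∧ ∀ t, |f t| ≤ C := by
  obtain ⟨l, -, H⟩ := hf.2 1 one_pos
  obtain ⟨C, hC⟩ := (isCompact_Icc (a := (0 : ℝ)) (b := l)).exists_bound_of_continuousOn
    hf.1.continuousOn
  refine ⟨max C 0 + 1, by positivity, fun t => ?_⟩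
  obtain ⟨r, hr, h⟩ := H (-t)
  have h1 := hC (t + r) ⟨by linarith [hr.1], by linarith [hr.2]⟩
  have h2 := h t
  rw [Real.norm_eq_abs] at h1
  rw [abs_sub_comm] at h2
  have h3 := abs_sub_abs_le_abs_sub (f t) (f (t + r))
  linarith [le_max_left C 0]

theorem BohrAP.uniformContinuous {f : ℝ → ℝ} (hf : BohrAP f) : UniformContinuous f := by
  rw [Metric.uniformContinuous_iff]
  intro ε hε
  obtain ⟨l, -, H⟩ := hf.2 (ε / 3) (by positivity)
  have hu := (isCompact_Icc (a := (-1 : ℝ)) (b := l + 1)).uniformContinuousOn_of_continuous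
    hf.1.continuousOn
  rw [Metric.uniformContinuousOn_iff] at hu
  obtain ⟨δ, hδ, hu⟩ := hu (ε / 3) (by positivity)
  refine ⟨min δ 1, by positivity, fun x y hxy => ?_⟩
  obtain ⟨r, hr, h⟩ := H (-x)
  rw [Real.dist_eq] at hxy ⊢
  have hxy1 := abs_lt.1 (hxy.trans_le (min_le_right _ _))
  have h1 := hu (x + r) ⟨by linarith [hr.1], by linarith [hr.2]⟩ (y + r)
    ⟨by linarith [hr.1], by linarith [hr.2]⟩ (by
      rw [Real.dist_eq, add_sub_add_right_eq_sub]
      exact hxy.trans_le (min_le_left _ _))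
  rw [Real.dist_eq, abs_lt] at h1
  have h2 := abs_lt.1 (h x)
  have h3 := abs_lt.1 (h y)
  rw [abs_lt]
  constructor <;> linarith [h1.1, h1.2, h2.1, h2.2, h3.1, h3.2]

theorem BohrAP.isPeriodFamily {f : ℝ → ℝ} (hf : BohrAP f) :
    IsPeriodFamily (almostPeriods f) where
  neg_mem _ _ := neg_mem_almostPeriods
  add_mem _ _ _ _ _ _ := add_mem_almostPeriods
  mem_nhds ε hε := by
    obtain ⟨δ, hδ, h⟩ := Metric.uniformContinuous_iff.1 hf.uniformContinuous ε hε
    filter_upwards [Metric.ball_mem_nhds (0 : ℝ) hδ] with r hr t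
    refine h ?_
    simpa using hr
  dense := hf.2

/-! ### Bounded sums of almost periodic sequences. -/

/-- Bohl–Bohr: if `F n - F (n - 1) = a n`, `a` is almost periodic and `F` is bounded, then every
sufficiently good almost period of `a` is an `ε`-almost period of `F`. Here the one-sided bound. -/
theorem exists_almostPeriods_sum_lower {F a : ℤ → ℝ} (ha : BohrAP a)
    (hF : ∀ n, F n = F (n - 1) + a n) {M : ℝ} (hM : ∀ n, |F n| ≤ M) {ε : ℝ} (hε : 0 < ε) :
    ∃ δ, 0 < δ ∧ ∀ p ∈ almostPeriods a δ, ∀ n, -ε < F (n + p) - F n := by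
  have hlow : BddBelow (range F) := ⟨-M, by rintro _ ⟨n, rfl⟩; exact (abs_le.1 (hM n)).1⟩
  have hupp : BddAbove (range F) := ⟨M, by rintro _ ⟨n, rfl⟩; exact (abs_le.1 (hM n)).2⟩
  have htel : ∀ (δ : ℝ) (p : ℤ), p ∈ almostPeriods a δ → ∀ (n : ℤ) (k : ℕ),
      |(F (n + k + p) - F (n + k)) - (F (n + p) - F n)| ≤ k * δ := by
    intro δ p hp n k
    induction k with
    | zero => simp
    | succ k ih =>
      have h1 := hF (n + (k + 1 : ℕ))
      have h2 := hF (n + (k + 1 : ℕ) + p)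
      have h3 := (hp (n + (k + 1 : ℕ))).le
      rw [show n + ((k + 1 : ℕ) : ℤ) - 1 = n + k by push_cast; ring] at h1
      rw [show n + ((k + 1 : ℕ) : ℤ) + p - 1 = n + k + p by push_cast; ring] at h2
      rw [h1, h2]
      push_cast at *
      rw [abs_le] at *
      constructor <;> linarith [h3.1, h3.2, ih.1, ih.2]
  -- The difference `F n₂ - F n₁` is almost the full oscillation of `F`. A good shift nearly
  -- preserves it, and `F (n₂ + p)` cannot exceed the supremum, so `F (n₁ + p)` is again near the
  -- infimum.
  obtain ⟨n₁, hn₁⟩ : ∃ n, F n < (⨅ n, F n) + ε / 8 :=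
    exists_lt_of_ciInf_lt (by linarith)
  obtain ⟨n₂, hn₂⟩ : ∃ n, (⨆ n, F n) - ε / 8 < F n :=
    exists_lt_of_lt_ciSup (by linarith)
  -- `F` comes close to its infimum in every long interval
  have hclose : ∃ l : ℕ, ∀ n, ∃ k : ℕ, k ≤ l ∧ F (n + k) < (⨅ n, F n) + ε / 2 := by
    set D : ℕ := (n₂ - n₁).natAbs
    obtain ⟨l, hl, Hl⟩ := ha.2 (ε / 8 / (D + 1)) (by positivity)
    refine ⟨l.toNat, fun n => ?_⟩
    obtain ⟨p, hp, hpa⟩ := Hl (n - n₁)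
    refine ⟨(n₁ + p - n).toNat, by have := hp.1; have := hp.2; omega, ?_⟩
    have e : n + ((n₁ + p - n).toNat : ℤ) = n₁ + p := by have := hp.1; omega
    rw [e]
    have hD : (D : ℝ) * (ε / 8 / (D + 1)) ≤ ε / 8 := by
      rw [mul_div_assoc', div_le_iff₀ (by positivity)]
      nlinarith
    have hcmp : |(F (n₂ + p) - F n₂) - (F (n₁ + p) - F n₁)| ≤ ε / 8 := by
      rcases le_total n₁ n₂ with h | h
      · have := htel _ p hpa n₁ D
        rw [show n₁ + (D : ℤ) = n₂ by omega] at this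
        linarith
      · have := htel _ p hpa n₂ D
        rw [show n₂ + (D : ℤ) = n₁ by omega, abs_sub_comm] at this
        linarith
    have h2 : F (n₂ + p) ≤ ⨆ n, F n := le_ciSup hupp _
    linarith [(abs_le.1 hcmp).1]
  obtain ⟨l, hl⟩ := hclose
  -- At a nearby `n + k` where `F` is almost minimal, the shift cannot lower `F` by more than `ε /
  -- 2`; returning to `n` takes `k ≤ l` steps and costs at most `ε / 4`.
  refine ⟨ε / 4 / (l + 1), by positivity, fun p hp n => ?_⟩
  obtain ⟨k, hk, hkF⟩ := hl n
  have h1 := (abs_le.1 (htel _ p hp n k)).2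
  have h2 : (⨅ n, F n) ≤ F (n + k + p) := ciInf_le hlow _
  have h3 : (k : ℝ) * (ε / 4 / (l + 1)) ≤ ε / 4 := by
    rw [mul_div_assoc', div_le_iff₀ (by positivity)]
    have : (k : ℝ) ≤ l := by exact_mod_cast hk
    nlinarith
  linarith

/-- The missing upper bound is the lower bound for `-p` at `n + p`. -/
theorem exists_almostPeriods_sum {F a : ℤ → ℝ} (ha : BohrAP a)
    (hF : ∀ n, F n = F (n - 1) + a n) {M : ℝ} (hM : ∀ n, |F n| ≤ M) {ε : ℝ} (hε : 0 < ε) :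
    ∃ δ, 0 < δ ∧ almostPeriods a δ ⊆ almostPeriods F ε := by
  obtain ⟨δ, hδ, H⟩ := exists_almostPeriods_sum_lower ha hF hM hε
  refine ⟨δ, hδ, fun p hp n => abs_lt.2 ⟨H p hp n, ?_⟩⟩
  have := H (-p) (neg_mem_almostPeriods hp) (n + p)
  rw [add_neg_cancel_right] at this
  linarith

/-! ### Almost periodicity of the product sequence. -/

theorem multSeq_zero (b : ℤ → ℝ) : multSeq b 0 = 1 := by simp [multSeq]

theorem multSeq_succ {b : ℤ → ℝ} (hb : ∀ n, 1 + b n ≠ 0) (n : ℤ) :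
    multSeq b n = (1 + b n) * multSeq b (n - 1) := by
  rcases lt_trichotomy n 0 with h | rfl | h
  · have e : Finset.Icc n 0 = insert n (Finset.Icc (n + 1) 0) := by
      ext k; simp only [Finset.mem_Icc, Finset.mem_insert]; omega
    rw [multSeq, multSeq, if_neg (by omega), if_neg (by omega), sub_add_cancel, e,
      Finset.prod_insert (by simp), ← mul_assoc, mul_one_div_cancel (hb n), one_mul]
  · simp [multSeq, hb 0]
  · have e : Finset.Icc 1 n = insert n (Finset.Icc 1 (n - 1)) := by
      ext k; simp only [Finset.mem_Icc, Finset.mem_insert]; omega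
    rw [multSeq, multSeq, if_pos (by omega), if_pos (by omega), e,
      Finset.prod_insert (by simp)]

theorem eq_multSeq_mul {b v : ℤ → ℝ} (hb : ∀ n, 1 + b n ≠ 0)
    (hv : ∀ n, v n = (1 + b n) * v (n - 1)) (n : ℤ) : v n = multSeq b n * v 0 := by
  induction n with
  | zero => simp [multSeq_zero]
  | succ n ih =>
    rw [hv, multSeq_succ hb, add_sub_cancel_right, ih, mul_assoc]
  | pred n ih =>
    rw [hv, multSeq_succ hb, mul_assoc] at ih
    exact mul_left_cancel₀ (hb _) ih

theorem Regular.exists_lower {b : ℤ → ℝ} (hb : Regular b) : ∃ c, 0 < c ∧ ∀ n, c ≤ |1 + b n| :=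
  ⟨_, hb.2.1, fun n => ciInf_le ⟨0, by rintro _ ⟨k, rfl⟩; exact abs_nonneg _⟩ n⟩

theorem Regular.ne_zero {b : ℤ → ℝ} (hb : Regular b) (n : ℤ) : 1 + b n ≠ 0 := by
  obtain ⟨c, hc, h⟩ := hb.exists_lower
  exact abs_pos.1 (hc.trans_le (h n))

theorem Regular.multSeq_bounds {b : ℤ → ℝ} (hb : Regular b) :
    ∃ m M, 0 < m ∧ 0 < M ∧ ∀ n, m ≤ |multSeq b n| ∧ |multSeq b n| ≤ M := by
  obtain ⟨v, hv, ⟨M, hM⟩, hinf⟩ := hb.2.2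
  have hlow : ∀ n, (⨅ n, |v n|) ≤ |v n| :=
    fun n => ciInf_le ⟨0, by rintro _ ⟨k, rfl⟩; exact abs_nonneg _⟩ n
  have hv0 : 0 < |v 0| := hinf.trans_le (hlow 0)
  have hMpos : 0 < M := hv0.trans_le (hM 0)
  have key : ∀ n, |multSeq b n| = |v n| / |v 0| := fun n => by
    rw [eq_multSeq_mul hb.ne_zero hv n, abs_mul, mul_div_cancel_right₀ _ hv0.ne']
  refine ⟨(⨅ n, |v n|) / |v 0|, M / |v 0|, by positivity, by positivity, fun n => ?_⟩
  rw [key]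
  exact ⟨by gcongr; exact hlow n, by gcongr; exact hM n⟩

/-- This and the next estimate translate between products and sums: log is Lipschitz on `[c, ∞)`,
exp on `(-∞, log M]`. Both follow from `log z ≤ z - 1`. -/
theorem abs_log_sub_log_le {c x y : ℝ} (hc : 0 < c) (hx : c ≤ x) (hy : c ≤ y) :
    |Real.log x - Real.log y| ≤ |x - y| / c := by
  have aux : ∀ x y : ℝ, c ≤ x → c ≤ y → Real.log x - Real.log y ≤ |x - y| / c := by
    intro x y hx hy
    have hx0 := hc.trans_le hx
    have hy0 := hc.trans_le hy
    rw [← Real.log_div hx0.ne' hy0.ne']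
    calc Real.log (x / y) ≤ x / y - 1 := Real.log_le_sub_one_of_pos (by positivity)
      _ = (x - y) / y := by field_simp
      _ ≤ |x - y| / y := by gcongr; exact le_abs_self _
      _ ≤ |x - y| / c := by gcongr
  rw [abs_le]
  have h1 := aux x y hx hy
  have h2 := aux y x hy hx
  rw [abs_sub_comm y x] at h2
  constructor <;> linarith

theorem abs_sub_le_of_abs_log_sub {M x y : ℝ} (hx : 0 < x) (hy : 0 < y)
    (hxM : x ≤ M) (hyM : y ≤ M) : |x - y| ≤ M * |Real.log x - Real.log y| := by
  have aux : ∀ x y : ℝ, 0 < x → 0 < y → x ≤ M → x - y ≤ M * |Real.log x - Real.log y| := by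
    intro x y hx hy hxM
    have h := Real.log_le_sub_one_of_pos (div_pos hy hx)
    rw [Real.log_div hy.ne' hx.ne'] at h
    have h1 : x - y ≤ x * (Real.log x - Real.log y) := by
      have : x * (y / x) = y := by field_simp
      nlinarith
    calc x - y ≤ x * (Real.log x - Real.log y) := h1
      _ ≤ x * |Real.log x - Real.log y| := by gcongr; exact le_abs_self _
      _ ≤ M * |Real.log x - Real.log y| := by gcongr
  rw [abs_le]
  have h1 := aux x y hx hy hxM
  have h2 := aux y x hy hx hyM
  rw [abs_sub_comm (Real.log y)] at h2
  constructor <;> linarith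

/-- An almost period of the multiplier that is so good that it preserves signs preserves the signs
of the solution when doubled. -/
theorem multSeq_mul_pos {b : ℤ → ℝ} (hb : ∀ n, 1 + b n ≠ 0) {p : ℤ}
    (hp : ∀ n, 0 < (1 + b (n + p)) * (1 + b n)) (n : ℤ) :
    0 < multSeq b (n + (p + p)) * multSeq b n := by
  have hne : ∀ n, multSeq b n ≠ 0 := fun n => by
    induction n with
    | zero => simp [multSeq_zero]
    | succ n ih =>
      rw [multSeq_succ hb, add_sub_cancel_right]
      exact mul_ne_zero (hb _) ih
    | pred n ih =>
      rw [multSeq_succ hb] at ih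
      exact right_ne_zero_of_mul ih
  -- The multipliers in the recurrence for `w` are positive, so `w` has constant sign, possibly
  -- negative. The product `w (n + p) * w n` is positive either way, and is `multSeq b (n + (p + p))
  -- * multSeq b n` times a square.
  set w : ℤ → ℝ := fun n => multSeq b (n + p) * multSeq b n with hw
  have hstep : ∀ n, w n = ((1 + b (n + p)) * (1 + b n)) * w (n - 1) := fun n => by
    simp only [hw]
    rw [multSeq_succ hb (n + p), multSeq_succ hb n, show n + p - 1 = n - 1 + p by ring]
    ring
  have hsign : ∀ n, 0 < w n * w 0 := fun n => by
    induction n with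
    | zero => exact mul_self_pos.2 (mul_ne_zero (hne _) (hne _))
    | succ n ih =>
      rw [hstep, add_sub_cancel_right, mul_assoc]
      exact mul_pos (hp _) ih
    | pred n ih =>
      rw [hstep, mul_assoc] at ih
      exact (mul_pos_iff_of_pos_left (hp _)).1 ih
  have h : 0 < (w (n + p) * w 0) * (w n * w 0) := mul_pos (hsign _) (hsign _)
  have e : (w (n + p) * w 0) * (w n * w 0)
      = (w 0 * multSeq b (n + p)) ^ 2 * (multSeq b (n + (p + p)) * multSeq b n) := by
    simp only [hw, ← add_assoc]
    ring
  rw [e] at h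
  exact (mul_pos_iff_of_pos_left (by have := mul_ne_zero (hne (0 + p)) (hne 0); have := hne (n + p); positivity)).1 h

theorem Regular.bohrAP_multSeq {b : ℤ → ℝ} (hb : Regular b) : BohrAP (multSeq b) := by
  refine ⟨continuous_of_discreteTopology, fun ε hε => ?_⟩
  obtain ⟨c, hc, hcb⟩ := hb.exists_lower
  obtain ⟨m, M, hm, hM, hbd⟩ := hb.multSeq_bounds
  have hne : ∀ n, multSeq b n ≠ 0 := fun n => abs_pos.1 (hm.trans_le (hbd n).1)
  have hlip : ∀ δ, 0 < δ →
      almostPeriods b (δ * c) ⊆ almostPeriods (fun n => Real.log |1 + b n|) δ := by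
    intro δ hδ p hp n
    have h1 := abs_log_sub_log_le hc (hcb (n + p)) (hcb n)
    have h2 := abs_abs_sub_abs_le (1 + b (n + p)) (1 + b n)
    rw [add_sub_add_left_eq_sub] at h2
    refine (h1.trans (div_le_div_of_nonneg_right h2 hc.le)).trans_lt ?_
    rw [div_lt_iff₀ hc]
    exact hp n
  have hlog : BohrAP (fun n => Real.log |1 + b n|) :=
    ⟨continuous_of_discreteTopology, fun δ hδ =>
      (hb.1.2 (δ * c) (by positivity)).mono (hlip δ hδ)⟩
  obtain ⟨δ, hδ, hsub⟩ := exists_almostPeriods_sum (F := fun n => Real.log |multSeq b n|)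
    (M := max |Real.log m| |Real.log M|) hlog
    (fun n => by
      rw [multSeq_succ hb.ne_zero n, abs_mul, Real.log_mul (abs_ne_zero.2 (hb.ne_zero n))
        (abs_ne_zero.2 (hne _)), add_comm])
    (fun n => abs_le_max_abs_abs (Real.log_le_log hm (hbd n).1)
      (Real.log_le_log (hm.trans_le (hbd n).1) (hbd n).2))
    (ε := ε / (M * 2)) (by positivity)
  -- `δ * c` controls the logarithms; `c` forces `1 + b (n + p)` to have the sign of `1 + b n`.
  obtain ⟨l, hl, H⟩ := hb.1.2 (min (δ * c) c) (by positivity)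
  refine ⟨l + l + 1, by omega, fun a => ?_⟩
  -- Integer division: twice `(a + 1) / 2` is `a` or `a + 1`, whence the length `l + l + 1` for `p +
  -- p`.
  obtain ⟨p, hp, hpb⟩ := H ((a + 1) / 2)
  have hp1 := hp.1
  have hp2 := hp.2
  refine ⟨p + p, ⟨by omega, by omega⟩, fun n => ?_⟩
  have hpF := hsub (hlip δ hδ (fun n => (hpb n).trans_le (min_le_left _ _)))
  have hppF := add_mem_almostPeriods hpF hpF n
  have hpos : 0 < multSeq b (n + (p + p)) * multSeq b n := by
    refine multSeq_mul_pos hb.ne_zero (fun k => ?_) n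
    have h1 := (hpb k).trans_le (min_le_right _ _)
    have h2 := hcb k
    rw [abs_lt] at h1
    rcases le_abs'.1 h2 with h3 | h3
    · exact mul_pos_of_neg_of_neg (by linarith [h1.2]) (by linarith)
    · exact mul_pos (by linarith [h1.1]) (by linarith)
  have hdist : |multSeq b (n + (p + p)) - multSeq b n|
      = |(|multSeq b (n + (p + p))|) - (|multSeq b n|)| := by
    rcases pos_and_pos_or_neg_and_neg_of_mul_pos hpos with ⟨h1, h2⟩ | ⟨h1, h2⟩
    · rw [abs_of_pos h1, abs_of_pos h2]
    · rw [abs_of_neg h1, abs_of_neg h2, ← abs_neg]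
      congr 1
      ring
  rw [hdist]
  calc _ ≤ M * |Real.log (|multSeq b (n + (p + p))|) - Real.log (|multSeq b n|)| :=
        abs_sub_le_of_abs_log_sub (abs_pos.2 (hne _)) (abs_pos.2 (hne _)) (hbd _).2 (hbd _).2
    _ < M * (ε / (M * 2) + ε / (M * 2)) := by gcongr
    _ = ε := by field_simp; ring

/-! ### Spacing of equi-potentially almost periodic sequences. -/

theorem Admissible.strictMono {τ : ℤ → ℝ} (hτ : Admissible τ) : StrictMono τ :=
  strictMono_int_of_lt_succ hτ.1

theorem Admissible.exists_mem_Ioc {τ : ℤ → ℝ} (hτ : Admissible τ) (t : ℝ) :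
    ∃ n, t ∈ Ioc (τ n) (τ (n + 1)) := by
  obtain ⟨a, ha⟩ := (hτ.2.2.eventually (eventually_lt_atBot t)).exists
  obtain ⟨c, hc⟩ := (hτ.2.1.eventually (eventually_ge_atTop t)).exists
  obtain ⟨n, hn, hmax⟩ := Int.exists_greatest_of_bdd (P := fun n => τ n < t)
    ⟨c, fun z hz => (hτ.strictMono.lt_iff_lt.1 (hz.trans_le hc)).le⟩ ⟨a, ha⟩
  refine ⟨n, hn, not_lt.1 fun h => ?_⟩
  have := hmax _ h
  omega

/-- Bounds on `τ (j + k) - τ j` uniform in `j` reduce to the finitely many base indices `0, …, l`,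
up to an error 1. -/
theorem EquipotentiallyAP.exists_window {τ : ℤ → ℝ} (hτ : EquipotentiallyAP τ) :
    ∃ l : ℤ, ∀ j, ∃ i ∈ Icc 0 l, ∀ k, |(τ (i + k) - τ i) - (τ (j + k) - τ j)| < 1 := by
  obtain ⟨l, -, H⟩ := hτ 1 one_pos
  refine ⟨l, fun j => ?_⟩
  obtain ⟨p, hp, h⟩ := H (-j)
  exact ⟨j + p, ⟨by linarith [hp.1], by linarith [hp.2]⟩, h j⟩

theorem EquipotentiallyAP.exists_sub_le {τ : ℤ → ℝ} (hτ : EquipotentiallyAP τ) (k : ℤ) :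
    ∃ C, ∀ j, τ (j + k) - τ j ≤ C := by
  obtain ⟨l, H⟩ := hτ.exists_window
  obtain ⟨C, hC⟩ := ((Finset.Icc 0 l).image fun i => τ (i + k) - τ i).exists_le
  refine ⟨C + 1, fun j => ?_⟩
  obtain ⟨i, hi, h⟩ := H j
  have := hC _ (Finset.mem_image_of_mem _ (Finset.mem_Icc.2 hi))
  linarith [(abs_lt.1 (h k)).1]

theorem EquipotentiallyAP.exists_le_sub {τ : ℤ → ℝ} (hτ : EquipotentiallyAP τ)
    (ha : Admissible τ) (D : ℝ) : ∃ k : ℕ, ∀ j, τ j + D ≤ τ (j + k) := by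
  obtain ⟨l, H⟩ := hτ.exists_window
  obtain ⟨K, hK, hK0⟩ := ((ha.2.1.eventually (eventually_ge_atTop (τ l + D + 1))).and
    (eventually_ge_atTop 0)).exists
  refine ⟨K.toNat, fun j => ?_⟩
  obtain ⟨i, hi, h⟩ := H j
  have h1 := (abs_lt.1 (h K)).2
  have h2 : τ i ≤ τ l := ha.strictMono.monotone hi.2
  have h3 : τ K ≤ τ (i + K) := ha.strictMono.monotone (by linarith [hi.1])
  rw [Int.toNat_of_nonneg hK0]
  linarith

/-- The number of points of `B` in an interval of length `3` is bounded. -/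
def UniformlySparse (B : Set ℝ) : Prop :=
  ∃ N : ℕ, ∀ x : ℝ, ∃ F : Finset ℝ, F.card ≤ N ∧ B ∩ Icc (x - 1) (x + 2) ⊆ F

theorem UniformlySparse.union {B C : Set ℝ} (hB : UniformlySparse B) (hC : UniformlySparse C) :
    UniformlySparse (B ∪ C) := by
  obtain ⟨N, hN⟩ := hB
  obtain ⟨M, hM⟩ := hC
  refine ⟨N + M, fun x => ?_⟩
  obtain ⟨F, hF, hFB⟩ := hN x
  obtain ⟨E, hE, hEC⟩ := hM x
  refine ⟨F ∪ E, (Finset.card_union_le _ _).trans (add_le_add hF hE), ?_⟩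
  rw [union_inter_distrib_right, Finset.coe_union]
  exact union_subset_union hFB hEC

theorem EquipotentiallyAP.uniformlySparse {τ : ℤ → ℝ} (hτ : EquipotentiallyAP τ)
    (ha : Admissible τ) : UniformlySparse (range τ) := by
  obtain ⟨k, hk⟩ := hτ.exists_le_sub ha 4
  refine ⟨k, fun x => ?_⟩
  obtain ⟨n, hn⟩ := ha.exists_mem_Ioc (x - 1)
  refine ⟨(Finset.Ico (n + 1) (n + 1 + k)).image τ, Finset.card_image_le.trans (by simp), ?_⟩
  rintro _ ⟨⟨j, rfl⟩, hj⟩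
  refine Finset.mem_coe.2 (Finset.mem_image_of_mem _ (Finset.mem_Ico.2 ⟨?_, ?_⟩))
  · exact ha.strictMono.lt_iff_lt.1 (hn.1.trans_le hj.1)
  · refine ha.strictMono.lt_iff_lt.1 ?_
    linarith [hk (n + 1), hj.2, hn.2]

/-! ### Almost periods in measure. -/

open MeasureTheory in
theorem volume_near_le {B : Set ℝ} {N : ℕ}
    (hN : ∀ x : ℝ, ∃ F : Finset ℝ, F.card ≤ N ∧ B ∩ Icc (x - 1) (x + 2) ⊆ F)
    {ε : ℝ} (hε : ε ≤ 1) (x : ℝ) :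
    volume {t | t ∈ Icc x (x + 1) ∧ ∃ c ∈ B, |t - c| ≤ ε} ≤ ENNReal.ofReal (N * (2 * ε)) := by
  obtain ⟨F, hF, hFB⟩ := hN x
  have hsub : {t | t ∈ Icc x (x + 1) ∧ ∃ c ∈ B, |t - c| ≤ ε} ⊆ ⋃ c ∈ F, Icc (c - ε) (c + ε) := by
    rintro t ⟨ht, c, hc, htc⟩
    have h := abs_le.1 htc
    refine mem_iUnion₂.2 ⟨c, hFB ⟨hc, ?_, ?_⟩, ?_, ?_⟩ <;> linarith [ht.1, ht.2, h.1, h.2]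
  calc volume {t | t ∈ Icc x (x + 1) ∧ ∃ c ∈ B, |t - c| ≤ ε}
      ≤ volume (⋃ c ∈ F, Icc (c - ε) (c + ε)) := measure_mono hsub
    _ ≤ ∑ c ∈ F, volume (Icc (c - ε) (c + ε)) := measure_biUnion_finset_le _ _
    _ = F.card * ENNReal.ofReal (2 * ε) := by
        simp only [Real.volume_Icc]
        rw [Finset.sum_congr rfl (fun c _ => by rw [show c + ε - (c - ε) = 2 * ε by ring]),
          Finset.sum_const, nsmul_eq_mul]
    _ ≤ N * ENNReal.ofReal (2 * ε) := by gcongr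
    _ = ENNReal.ofReal (N * (2 * ε)) := by
        rw [ENNReal.ofReal_mul (Nat.cast_nonneg N), ENNReal.ofReal_natCast]

/-- The `ε`-almost periods of `h` in the sense of uniform local convergence in measure. -/
def meanPeriods (h : ℝ → ℝ) (ε : ℝ) : Set ℝ :=
  {r | ∀ x, MeasureTheory.volume {t | t ∈ Icc x (x + 1) ∧ ε ≤ |h (t + r) - h t|}
    ≤ ENNReal.ofReal ε}

open MeasureTheory in
theorem volume_shift_deviation (h : ℝ → ℝ) (ε r s x : ℝ) :
    volume {t | t ∈ Icc x (x + 1) ∧ ε ≤ |h (t + s + r) - h (t + s)|} =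
      volume {t | t ∈ Icc (x + s) (x + s + 1) ∧ ε ≤ |h (t + r) - h t|} := by
  rw [← measure_preimage_add_right volume s
    {t | t ∈ Icc (x + s) (x + s + 1) ∧ ε ≤ |h (t + r) - h t|}]
  congr 1
  ext t
  simp only [mem_ofPred_eq, mem_Icc, preimage_ofPred_eq]
  constructor <;> rintro ⟨⟨h1, h2⟩, h3⟩ <;> exact ⟨⟨by linarith, by linarith⟩, h3⟩

theorem neg_mem_meanPeriods {h : ℝ → ℝ} {ε r : ℝ} (hr : r ∈ meanPeriods h ε) :
    -r ∈ meanPeriods h ε := fun x => by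
  have h1 := hr (x + -r)
  rw [← volume_shift_deviation] at h1
  simpa only [neg_add_cancel_right, abs_sub_comm] using h1

open MeasureTheory in
theorem add_mem_meanPeriods {h : ℝ → ℝ} {ε δ r s : ℝ} (hε : 0 < ε) (hδ : 0 < δ)
    (hr : r ∈ meanPeriods h ε) (hs : s ∈ meanPeriods h δ) :
    r + s ∈ meanPeriods h (ε + δ) := fun x => by
  have h1 := hs (x + r)
  rw [← volume_shift_deviation] at h1
  rw [ENNReal.ofReal_add hε.le hδ.le]
  refine (measure_mono ?_).trans ((measure_union_le _ _).trans (add_le_add (hr x) h1))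
  rintro t ⟨ht, hd⟩
  by_contra hcon
  simp only [mem_union, mem_ofPred_eq, not_or, not_and, not_le] at hcon
  have h2 := hcon.1 ht
  have h3 := hcon.2 ht
  rw [← add_assoc] at hd
  have := abs_sub_le (h (t + r + s)) (h (t + r)) (h t)
  linarith

/-- A unit interval meets the `δ`-neighbourhoods of at most `N` break points, so the exceptional set
has measure at most `2 * N * δ`. -/
theorem UniformlySparse.exists_mem_meanPeriods {B : Set ℝ} (hB : UniformlySparse B)
    {ε : ℝ} (hε : 0 < ε) : ∃ δ, 0 < δ ∧ δ ≤ ε ∧ ∀ (h : ℝ → ℝ) (r : ℝ),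
      (∀ t, (∀ c ∈ B, δ < |t - c|) → |h (t + r) - h t| < ε) → r ∈ meanPeriods h ε := by
  obtain ⟨N, hN⟩ := hB
  have hq : 0 < ε / (2 * N + 1) := by positivity
  refine ⟨min 1 (ε / (2 * N + 1)), by positivity, ?_, fun h r H x => ?_⟩
  · refine (min_le_right _ _).trans (div_le_self hε.le ?_)
    linarith [(Nat.cast_nonneg N : (0 : ℝ) ≤ N)]
  · refine (MeasureTheory.measure_mono ?_).trans ((volume_near_le hN
      (min_le_left 1 (ε / (2 * N + 1))) x).trans
      (ENNReal.ofReal_le_ofReal ?_))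
    · rintro t ⟨ht, hd⟩
      refine ⟨ht, ?_⟩
      by_contra! hcon
      exact absurd (H t hcon) (not_lt.2 hd)
    · calc (N : ℝ) * (2 * min 1 (ε / (2 * N + 1))) ≤ N * (2 * (ε / (2 * N + 1))) := by
            gcongr
            exact min_le_right _ _
        _ = ε * (2 * N / (2 * N + 1)) := by ring
        _ ≤ ε := mul_le_of_le_one_right hε.le ((div_le_one (by positivity)).2 (by linarith))

theorem exists_mem_Icc_not_mem {S : Set ℝ} {a δ : ℝ} (hS : MeasureTheory.volume S ≤ ENNReal.ofReal a)
    (hδ : 0 < δ) (ha : a < δ) (x : ℝ) : ∃ t ∈ Icc x (x + δ), t ∉ S := by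
  by_contra! hcon
  have h := (MeasureTheory.measure_mono (μ := MeasureTheory.volume) hcon).trans hS
  rw [Real.volume_Icc, add_sub_cancel_left] at h
  exact absurd h (not_le.2 ((ENNReal.ofReal_lt_ofReal_iff hδ).2 ha))

/-! ### Almost periods of p.c.a.p. functions and of step functions. -/

/-- The regularity and recurrence conditions in the definition of p.c.a.p. functions, with respect
to a given sequence. -/
structure PCAPAlong (τ : ℤ → ℝ) (h : ℝ → ℝ) : Prop where
  admissible : Admissible τ
  equipotential : EquipotentiallyAP τ
  equicontinuous : ∀ ε : ℝ, 0 < ε → ∃ δ : ℝ, 0 < δ ∧ ∀ j : ℤ, ∀ s ∈ Ioc (τ j) (τ (j + 1)),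
    ∀ t ∈ Ioc (τ j) (τ (j + 1)), |s - t| < δ → |h s - h t| < ε
  dense : ∀ ε : ℝ, 0 < ε → RelativelyDense
    {r : ℝ | ∀ t : ℝ, (∀ j : ℤ, ε < |t - τ j|) → |h (t + r) - h t| < ε}

theorem lt_sub_of_forall_lt_abs {τ : ℤ → ℝ} {ε t : ℝ} {n : ℤ}
    (h : t ∈ Ioc (τ n) (τ (n + 1))) (hfar : ∀ j, ε < |t - τ j|) :
    τ n + ε < t ∧ t + ε < τ (n + 1) := by
  have h1 := hfar n
  have h2 := hfar (n + 1)
  rw [abs_of_pos (sub_pos.2 h.1)] at h1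
  rw [abs_of_nonpos (sub_nonpos.2 h.2)] at h2
  constructor <;> linarith

theorem PCAPAlong.isPeriodFamily {τ : ℤ → ℝ} {h : ℝ → ℝ} (H : PCAPAlong τ h) :
    IsPeriodFamily (meanPeriods h) where
  neg_mem _ _ := neg_mem_meanPeriods
  add_mem _ _ hε hδ _ _ := add_mem_meanPeriods hε hδ
  mem_nhds ε hε := by
    obtain ⟨δ, hδ, -, hmem⟩ :=
      (H.equipotential.uniformlySparse H.admissible).exists_mem_meanPeriods hε
    obtain ⟨η, hη, heq⟩ := H.equicontinuous ε hε
    filter_upwards [Metric.ball_mem_nhds (0 : ℝ) (lt_min hδ hη)] with r hr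
    rw [mem_ball_zero_iff, Real.norm_eq_abs] at hr
    refine hmem h r fun t ht => ?_
    obtain ⟨n, hn⟩ := H.admissible.exists_mem_Ioc t
    have h1 := lt_sub_of_forall_lt_abs hn fun j => ht _ (mem_range_self j)
    have h2 := abs_lt.1 (hr.trans_le (min_le_left _ _))
    refine heq n _ ⟨by linarith, by linarith⟩ _ hn ?_
    rw [add_sub_cancel_left]
    exact hr.trans_le (min_le_right _ _)
  dense ε hε := by
    obtain ⟨δ, hδ, hδε, hmem⟩ :=
      (H.equipotential.uniformlySparse H.admissible).exists_mem_meanPeriods hε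
    refine (H.dense δ hδ).mono fun r hr => hmem h r fun t ht => ?_
    exact (hr t fun j => ht _ (mem_range_self j)).trans_le hδε

/-- The real numbers `r` that approximately shift the sequence `τ` by an index that is an
`ε`-almost period of `u`. -/
def stepPeriods (τ u : ℤ → ℝ) (ε : ℝ) : Set ℝ :=
  {r | ∃ p ∈ almostPeriods u ε, ∀ j, |τ (j + p) - τ j - r| < ε}

/-- The almost periods of an equi-potentially almost periodic sequence. -/
def indexPeriods (τ : ℤ → ℝ) (ε : ℝ) : Set ℤ :=
  {p | ∀ j k : ℤ, |(τ (j + p + k) - τ (j + p)) - (τ (j + k) - τ j)| < ε}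

theorem EquipotentiallyAP.isPeriodFamily {τ : ℤ → ℝ} (hτ : EquipotentiallyAP τ) :
    IsPeriodFamily (indexPeriods τ) where
  neg_mem ε p hp j k := by
    have := hp (j + -p) k
    rw [neg_add_cancel_right, abs_sub_comm] at this
    exact this
  add_mem ε δ _ _ p q hp hq j k := by
    have h1 := abs_lt.1 (hp j k)
    have h2 := abs_lt.1 (hq (j + p) k)
    rw [← add_assoc j p q, abs_lt]
    constructor <;> linarith [h1.1, h1.2, h2.1, h2.2]
  mem_nhds ε hε := by
    rw [nhds_discrete, mem_pure]
    intro j k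
    simpa using hε
  dense := hτ

/-- For density, a common almost period `p` of `u` and of the differences of `τ` yields the real
period `τ p - τ 0`; the bounded gaps of `τ` carry relative density from ℤ to ℝ. -/
theorem isPeriodFamily_stepPeriods {τ u : ℤ → ℝ} (ha : Admissible τ) (hτ : EquipotentiallyAP τ)
    (hu : BohrAP u) : IsPeriodFamily (stepPeriods τ u) where
  neg_mem ε r := by
    rintro ⟨p, hp, h⟩
    refine ⟨-p, neg_mem_almostPeriods hp, fun j => ?_⟩
    have := abs_lt.1 (h (j + -p))
    rw [neg_add_cancel_right] at this
    rw [abs_lt]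
    constructor <;> linarith [this.1, this.2]
  add_mem ε δ _ _ r s := by
    rintro ⟨p, hp, h⟩ ⟨q, hq, h'⟩
    refine ⟨p + q, add_mem_almostPeriods hp hq, fun j => ?_⟩
    have h1 := abs_lt.1 (h j)
    have h2 := abs_lt.1 (h' (j + p))
    rw [← add_assoc, abs_lt]
    constructor <;> linarith [h1.1, h1.2, h2.1, h2.2]
  mem_nhds ε hε := by
    filter_upwards [Metric.ball_mem_nhds (0 : ℝ) hε] with r hr
    refine ⟨0, fun t => by simpa using hε, fun j => ?_⟩
    simpa using hr
  dense ε hε := by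
    obtain ⟨l, hl, H⟩ := hu.isPeriodFamily_int.relativelyDense_inter hτ.isPeriodFamily hε
    obtain ⟨C, hC⟩ := hτ.exists_sub_le (l + 1)
    refine ⟨max C 1, by positivity, fun a => ?_⟩
    obtain ⟨n, hn⟩ := ha.exists_mem_Ioc (a + τ 0)
    obtain ⟨p, hp, hpu, hpτ⟩ := H (n + 1)
    refine ⟨τ p - τ 0, ⟨?_, ?_⟩, p, hpu, fun j => ?_⟩
    · have : τ (n + 1) ≤ τ p := ha.strictMono.monotone hp.1
      linarith [hn.2]
    · have : τ p ≤ τ (n + (l + 1)) := ha.strictMono.monotone (by linarith [hp.2])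
      linarith [hn.1, hC n, le_max_left C 1]
    · have := hpτ 0 j
      simp only [zero_add] at this
      rw [show τ (j + p) - τ j - (τ p - τ 0) = τ (p + j) - τ p - (τ j - τ 0) by
        rw [add_comm]; ring]
      exact this

theorem stepFun_sub_lt {τ b : ℤ → ℝ} (ha : Admissible τ) {ε r t : ℝ}
    (hr : r ∈ stepPeriods τ (multSeq b) ε) (hfar : ∀ j, ε < |t - τ j|) :
    |stepFun τ b (t + r) - stepFun τ b t| < ε := by
  obtain ⟨p, hp, h⟩ := hr
  obtain ⟨n, hn⟩ := ha.exists_mem_Ioc t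
  have h1 := lt_sub_of_forall_lt_abs hn hfar
  have h2 := abs_lt.1 (h n)
  have h3 := abs_lt.1 (h (n + 1))
  rw [add_right_comm] at h3
  rw [stepFun_eq ha b hn.1 hn.2, stepFun_eq ha b (n := n + p) (by linarith) (by linarith)]
  exact hp n

theorem Regular.pcapAlong_stepFun {τ b : ℤ → ℝ} (hb : Regular b) (ha : Admissible τ)
    (hτ : EquipotentiallyAP τ) : PCAPAlong τ (stepFun τ b) where
  admissible := ha
  equipotential := hτ
  equicontinuous ε hε := by
    refine ⟨1, one_pos, fun j s hs t ht _ => ?_⟩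
    rw [stepFun_eq ha b hs.1 hs.2, stepFun_eq ha b ht.1 ht.2, sub_self, abs_zero]
    exact hε
  dense ε hε := ((isPeriodFamily_stepPeriods ha hτ hb.bohrAP_multSeq).dense ε hε).mono
    fun _ hr _ ht => stepFun_sub_lt ha hr ht

theorem Regular.stepFun_bounds {b : ℤ → ℝ} (hb : Regular b) (τ : ℤ → ℝ) :
    ∃ m M, 0 < m ∧ 0 < M ∧ ∀ t, m ≤ |stepFun τ b t| ∧ |stepFun τ b t| ≤ M := by
  obtain ⟨m, M, hm, hM, h⟩ := hb.multSeq_bounds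
  exact ⟨m, M, hm, hM, fun t => h _⟩

/-! ### Uniform continuity across break points. -/

/-- A continuous function that varies little between break points varies little on intervals with
few break points. -/
theorem abs_sub_le_of_breaks {f : ℝ → ℝ} (hf : Continuous f) {B : Set ℝ} {ε δ : ℝ} (hε : 0 ≤ ε)
    (h : ∀ s t, s < t → t - s < δ → B ∩ Ico s t = ∅ → |f s - f t| ≤ ε) (N : ℕ) :
    ∀ (F : Finset ℝ) (s t : ℝ), F.card ≤ N → s < t → t - s < δ → B ∩ Ioo s t ⊆ F →
      |f s - f t| ≤ (F.card + 1) * ε := by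
  induction N with
  | zero =>
    intro F s t hF hst hδ hB
    rw [Nat.le_zero, Finset.card_eq_zero] at hF
    subst hF
    rw [Finset.coe_empty, subset_empty_iff] at hB
    -- The left end `s` may itself be a break point; continuity of `f` allows approaching it from
    -- the right.
    have hlim : Tendsto (fun s' => |f s' - f t|) (𝓝[>] s) (𝓝 |f s - f t|) :=
      ((hf.sub continuous_const).abs.tendsto s).mono_left nhdsWithin_le_nhds
    simp only [Finset.card_empty, Nat.cast_zero, zero_add, one_mul]
    refine le_of_tendsto hlim ?_
    filter_upwards [Ioo_mem_nhdsGT hst] with s' hs'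
    refine h s' t hs'.2 (by linarith [hs'.1]) (subset_empty_iff.1 ?_)
    rw [← hB]
    exact inter_subset_inter_right _ fun c hc => ⟨hs'.1.trans_le hc.1, hc.2⟩
  | succ N ih =>
    intro F s t hF hst hδ hB
    rcases (B ∩ Ioo s t).eq_empty_or_nonempty with he | ⟨c, hcB, hc⟩
    · have := ih ∅ s t (by simp) hst hδ (by simp [he])
      simp only [Finset.card_empty, Nat.cast_zero, zero_add, one_mul] at this
      exact this.trans (le_mul_of_one_le_left hε (by simp))
    · have hcF : c ∈ F := hB ⟨hcB, hc⟩
      have hdisj : Disjoint (F.filter (· < c)) (F.filter (c < ·)) :=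
        Finset.disjoint_filter.2 fun _ _ h1 h2 => lt_asymm h1 h2
      have hcard : (F.filter (· < c)).card + (F.filter (c < ·)).card + 1 ≤ F.card := by
        rw [← Finset.card_union_of_disjoint hdisj, Nat.add_one_le_iff]
        refine Finset.card_lt_card (Finset.ssubset_iff_of_subset ?_ |>.2 ⟨c, hcF, ?_⟩)
        · exact Finset.union_subset (Finset.filter_subset _ _) (Finset.filter_subset _ _)
        · simp
      have h1 := ih (F.filter (· < c)) s c (by omega) hc.1 (by linarith [hc.2]) (fun y hy => by
        simpa using ⟨hB ⟨hy.1, hy.2.1, hy.2.2.trans hc.2⟩, hy.2.2⟩)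
      have h2 := ih (F.filter (c < ·)) c t (by omega) hc.2 (by linarith [hc.1]) (fun y hy => by
        simpa using ⟨hB ⟨hy.1, hc.1.trans hy.2.1, hy.2.2⟩, hy.2.1⟩)
      have hcard' : ((F.filter (· < c)).card : ℝ) + (F.filter (c < ·)).card + 1 ≤ F.card := by
        exact_mod_cast hcard
      calc |f s - f t| ≤ |f s - f c| + |f c - f t| := abs_sub_le _ _ _
        _ ≤ _ := add_le_add h1 h2
        _ = ((F.filter (· < c)).card + (F.filter (c < ·)).card + 1 + 1) * ε := by ring
        _ ≤ (F.card + 1) * ε := by gcongr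

theorem uniformContinuous_of_breaks {f : ℝ → ℝ} (hf : Continuous f) {B : Set ℝ}
    (hB : UniformlySparse B)
    (h : ∀ ε, 0 < ε → ∃ δ, 0 < δ ∧
      ∀ s t, s < t → t - s < δ → B ∩ Ico s t = ∅ → |f s - f t| ≤ ε) :
    UniformContinuous f := by
  obtain ⟨N, hN⟩ := hB
  rw [Metric.uniformContinuous_iff]
  intro ε hε
  obtain ⟨δ, hδ, H⟩ := h (ε / (N + 2)) (by positivity)
  have key : ∀ s t, s < t → t - s < min δ 1 → |f s - f t| < ε := by
    intro s t hst hd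
    obtain ⟨F, hF, hFB⟩ := hN s
    have hd1 := hd.trans_le (min_le_right _ _)
    have h1 := abs_sub_le_of_breaks hf (by positivity) H N F s t hF hst
      (hd.trans_le (min_le_left _ _)) fun c hc =>
        hFB ⟨hc.1, by linarith [hc.2.1], by linarith [hc.2.2]⟩
    calc |f s - f t| ≤ (F.card + 1) * (ε / (N + 2)) := h1
      _ ≤ (N + 1) * (ε / (N + 2)) := by gcongr
      _ < (N + 2) * (ε / (N + 2)) := by gcongr; linarith
      _ = ε := by field_simp
  refine ⟨min δ 1, by positivity, fun {s t} hd => ?_⟩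
  rw [Real.dist_eq] at hd ⊢
  have hd' := abs_lt.1 hd
  rcases lt_trichotomy s t with hst | rfl | hst
  · exact key s t hst (by linarith)
  · simpa using hε
  · rw [abs_sub_comm]
    exact key t s hst (by linarith)

/-! ### Equivalence of the two systems. -/

theorem Admissible.exists_mem_Ioo {τ : ℤ → ℝ} (ha : Admissible τ) {t : ℝ} (ht : t ∉ range τ) :
    ∃ n, t ∈ Ioo (τ n) (τ (n + 1)) := by
  obtain ⟨n, hn⟩ := ha.exists_mem_Ioc t
  exact ⟨n, hn.1, lt_of_le_of_ne hn.2 fun h => ht ⟨_, h.symm⟩⟩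

theorem stepFun_eventuallyEq {τ : ℤ → ℝ} (ha : Admissible τ) (b : ℤ → ℝ) {t : ℝ}
    (ht : t ∉ range τ) : stepFun τ b =ᶠ[𝓝 t] fun _ => stepFun τ b t := by
  obtain ⟨n, hn⟩ := ha.exists_mem_Ioo ht
  filter_upwards [Ioo_mem_nhds hn.1 hn.2] with s hs
  rw [stepFun_eq ha b hs.1 hs.2.le, stepFun_eq ha b hn.1 hn.2.le]

theorem stepFun_apply {τ : ℤ → ℝ} (ha : Admissible τ) (b : ℤ → ℝ) (n : ℤ) :
    stepFun τ b (τ n) = multSeq b (n - 1) := by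
  refine stepFun_eq ha b (ha.strictMono (by omega)) ?_
  rw [sub_add_cancel]

theorem stepFun_eventuallyEq_left {τ : ℤ → ℝ} (ha : Admissible τ) (b : ℤ → ℝ) (n : ℤ) :
    stepFun τ b =ᶠ[𝓝[≤] (τ n)] fun _ => stepFun τ b (τ n) := by
  have h : τ (n - 1) < τ n := ha.strictMono (by omega)
  filter_upwards [Ioc_mem_nhdsLE h] with s hs
  rw [stepFun_apply ha, stepFun_eq ha b hs.1 (by rw [sub_add_cancel]; exact hs.2)]

theorem stepFun_eventuallyEq_right {τ : ℤ → ℝ} (ha : Admissible τ) (b : ℤ → ℝ) (n : ℤ) :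
    stepFun τ b =ᶠ[𝓝[>] (τ n)] fun _ => multSeq b n := by
  filter_upwards [Ioc_mem_nhdsGT (ha.1 n)] with s hs
  exact stepFun_eq ha b hs.1 hs.2

variable {d : ℕ} {g : Fin d → (Fin d → ℝ) → ℝ → ℝ} {τ : ℤ → ℝ} {b : Fin d → ℤ → ℝ}
  {φ : Fin d → ℝ → ℝ}

theorem IsImpulsiveSolution.continuous_div (hφ : IsImpulsiveSolution g τ b φ)
    (ha : Admissible τ) (hb : ∀ i n, 1 + b i n ≠ 0) (hψ : ∀ i t, stepFun τ (b i) t ≠ 0)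
    (i : Fin d) : Continuous fun t => φ i t / stepFun τ (b i) t := by
  rw [continuous_iff_continuousAt]
  intro t
  by_cases ht : t ∈ range τ
  · obtain ⟨n, rfl⟩ := ht
    obtain ⟨hl, hr⟩ := (hφ i).2 n
    rw [continuousAt_iff_continuous_left'_right', ContinuousWithinAt, ContinuousWithinAt]
    constructor
    · have h1 := hl.div_const (stepFun τ (b i) (τ n))
      have h2 : Tendsto (fun t => φ i t / stepFun τ (b i) t) (𝓝[≤] (τ n))
          (𝓝 (φ i (τ n) / stepFun τ (b i) (τ n))) := by
        refine Tendsto.congr' ?_ h1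
        filter_upwards [stepFun_eventuallyEq_left ha (b i) n] with s hs
        rw [hs]
      exact h2.mono_left (nhdsWithin_mono _ Iio_subset_Iic_self)
    · have h1 := hr.div_const (multSeq (b i) n)
      have e : (1 + b i n) * φ i (τ n) / multSeq (b i) n
          = φ i (τ n) / stepFun τ (b i) (τ n) := by
        rw [stepFun_apply ha, multSeq_succ (hb i), mul_div_mul_left _ _ (hb i n)]
      rw [e] at h1
      refine Tendsto.congr' ?_ h1
      filter_upwards [stepFun_eventuallyEq_right ha (b i) n] with s hs
      rw [hs]
  · have h1 := ((hφ i).1 t ht).continuousAt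
    refine h1.div ?_ (hψ i t)
    exact continuousAt_const.congr (stepFun_eventuallyEq ha (b i) ht).symm

theorem IsImpulsiveSolution.isTransformedSolution (hφ : IsImpulsiveSolution g τ b φ)
    (ha : Admissible τ) (hb : ∀ i n, 1 + b i n ≠ 0) (hψ : ∀ i t, stepFun τ (b i) t ≠ 0) :
    IsTransformedSolution g τ b (fun i t => φ i t / stepFun τ (b i) t) := by
  refine fun i => ⟨hφ.continuous_div ha hb hψ i, fun t ht => ?_⟩
  have e : (fun j => stepFun τ (b j) t * (φ j t / stepFun τ (b j) t)) = fun j => φ j t :=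
    funext fun j => mul_div_cancel₀ _ (hψ j t)
  rw [e]
  refine (((hφ i).1 t ht).div_const (stepFun τ (b i) t)).congr_of_eventuallyEq ?_
  filter_upwards [stepFun_eventuallyEq ha (b i) ht] with s hs
  rw [hs]

theorem IsTransformedSolution.isImpulsiveSolution
    (hφ : IsTransformedSolution g τ b (fun i t => φ i t / stepFun τ (b i) t))
    (ha : Admissible τ) (hb : ∀ i n, 1 + b i n ≠ 0) (hψ : ∀ i t, stepFun τ (b i) t ≠ 0) :
    IsImpulsiveSolution g τ b φ := by
  have hmul : ∀ i t, φ i t = φ i t / stepFun τ (b i) t * stepFun τ (b i) t :=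
    fun i t => (div_mul_cancel₀ _ (hψ i t)).symm
  refine fun i => ⟨fun t ht => ?_, fun n => ⟨?_, ?_⟩⟩
  · have h1 := ((hφ i).2 t ht).mul_const (stepFun τ (b i) t)
    have e : (fun j => stepFun τ (b j) t * (φ j t / stepFun τ (b j) t)) = fun j => φ j t :=
      funext fun j => mul_div_cancel₀ _ (hψ j t)
    rw [e, div_mul_cancel₀ _ (hψ i t)] at h1
    refine h1.congr_of_eventuallyEq ?_
    filter_upwards [stepFun_eventuallyEq ha (b i) ht] with s hs
    rw [← hs]
    exact hmul i s
  · have h1 : Tendsto (fun t => φ i t / stepFun τ (b i) t * stepFun τ (b i) (τ n))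
        (𝓝[≤] (τ n)) (𝓝 (φ i (τ n) / stepFun τ (b i) (τ n) * stepFun τ (b i) (τ n))) :=
      (((hφ i).1.tendsto _).mono_left nhdsWithin_le_nhds).mul_const _
    rw [← hmul] at h1
    refine Tendsto.congr' ?_ h1
    filter_upwards [stepFun_eventuallyEq_left ha (b i) n] with s hs
    rw [← hs]
    exact (hmul i s).symm
  · have h1 : Tendsto (fun t => φ i t / stepFun τ (b i) t * multSeq (b i) n)
        (𝓝[>] (τ n)) (𝓝 (φ i (τ n) / stepFun τ (b i) (τ n) * multSeq (b i) n)) :=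
      (((hφ i).1.tendsto _).mono_left nhdsWithin_le_nhds).mul_const _
    have e : φ i (τ n) / stepFun τ (b i) (τ n) * multSeq (b i) n = (1 + b i n) * φ i (τ n) := by
      rw [multSeq_succ (hb i), ← stepFun_apply ha, mul_left_comm, ← hmul]
    rw [e] at h1
    refine Tendsto.congr' ?_ h1
    filter_upwards [stepFun_eventuallyEq_right ha (b i) n] with s hs
    rw [← hs]
    exact (hmul i s).symm

/-! ### Almost periodicity of the quotient. -/

theorem IsPCAP.exists_pcapAlong {h : ℝ → ℝ} (hh : IsPCAP h) : ∃ σ, PCAPAlong σ h := by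
  obtain ⟨-, σ, ha, -, hσ, heq, hd⟩ := hh
  exact ⟨σ, ha, hσ, heq, hd⟩

/-- The error is expressed through `|x / y|` because the quotient is what gets bounded beforehand.
-/
theorem abs_div_sub_div_le {m x y x' y' : ℝ} (hm : 0 < m) (hy : m ≤ |y|) (hy' : m ≤ |y'|) :
    |x' / y' - x / y| ≤ (|x' - x| + |x / y| * |y' - y|) / m := by
  have hy0 : y ≠ 0 := abs_pos.1 (hm.trans_le hy)
  have hy0' : y' ≠ 0 := abs_pos.1 (hm.trans_le hy')
  have e : x' / y' - x / y = ((x' - x) - x / y * (y' - y)) / y' := by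
    field_simp
    ring
  rw [e, abs_div]
  gcongr
  exact (abs_sub _ _).trans_eq (by rw [abs_mul])

theorem PCAPAlong.exists_mem_Ioc_of_breaks {σ : ℤ → ℝ} {h : ℝ → ℝ} (hσ : PCAPAlong σ h) {s t : ℝ}
    (hst : s < t) (hB : range σ ∩ Ico s t = ∅) :
    ∃ n, s ∈ Ioc (σ n) (σ (n + 1)) ∧ t ∈ Ioc (σ n) (σ (n + 1)) := by
  obtain ⟨n, hn⟩ := hσ.admissible.exists_mem_Ioc s
  refine ⟨n, hn, hn.1.trans hst, not_lt.1 fun hlt => ?_⟩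
  have : σ (n + 1) ∈ range σ ∩ Ico s t := ⟨mem_range_self _, hn.2, hlt⟩
  rw [hB] at this
  exact this

section Quotient

variable {σ ρ : ℤ → ℝ} {h ψ : ℝ → ℝ} {m M : ℝ}

theorem PCAPAlong.uniformContinuous_div (hσ : PCAPAlong σ h) (hρ : PCAPAlong ρ ψ)
    (hconst : ∀ n, ∀ s ∈ Ioc (ρ n) (ρ (n + 1)), ∀ t ∈ Ioc (ρ n) (ρ (n + 1)), ψ s = ψ t)
    (hm : 0 < m) (hψ : ∀ t, m ≤ |ψ t|) (hf : Continuous fun t => h t / ψ t) :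
    UniformContinuous fun t => h t / ψ t := by
  refine uniformContinuous_of_breaks hf ((hσ.equipotential.uniformlySparse hσ.admissible).union
    (hρ.equipotential.uniformlySparse hρ.admissible)) fun ε hε => ?_
  obtain ⟨δ, hδ, H⟩ := hσ.equicontinuous (ε * m) (by positivity)
  refine ⟨δ, hδ, fun s t hst hd hB => ?_⟩
  rw [union_inter_distrib_right, union_empty_iff] at hB
  obtain ⟨n, hsn, htn⟩ := hσ.exists_mem_Ioc_of_breaks hst hB.1
  obtain ⟨k, hsk, htk⟩ := hρ.exists_mem_Ioc_of_breaks hst hB.2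
  rw [hconst k s hsk t htk, ← sub_div, abs_div, div_le_iff₀ (hm.trans_le (hψ t))]
  have h1 := H n s hsn t htn (by rw [abs_sub_comm, abs_of_pos (sub_pos.2 hst)]; exact hd)
  have h2 : ε * m ≤ ε * |ψ t| := by gcongr; exact hψ t
  linarith

/-- Near any `x` there is a point `t` off the exceptional set, and a period moves it into a fixed
compact interval, where the quotient is bounded. Uniform continuity leads back from `t` to `x`. -/
theorem PCAPAlong.exists_bound_div (hσ : PCAPAlong σ h)
    (hm : 0 < m) (hψ : ∀ t, m ≤ |ψ t|) (hM : 0 < M) (hψM : ∀ t, |ψ t| ≤ M)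
    (hf : UniformContinuous fun t => h t / ψ t) : ∃ C, 0 < C ∧ ∀ t, |h t / ψ t| ≤ C := by
  obtain ⟨δ, hδ, hu⟩ := Metric.uniformContinuous_iff.1 hf 1 one_pos
  set η := min δ 1 / 4 with hη
  have hη0 : 0 < η := by positivity
  have hηδ : 2 * η < δ := by linarith [min_le_left δ 1]
  have hη1 : 2 * η ≤ 1 := by linarith [min_le_right δ 1]
  obtain ⟨l, hl, H⟩ := hσ.isPeriodFamily.dense η hη0
  obtain ⟨C, hC⟩ := (isCompact_Icc (a := (0 : ℝ)) (b := l + 1)).exists_bound_of_continuousOn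
    hf.continuous.continuousOn
  refine ⟨(M * max C 0 + 1) / m + 1, by positivity, fun x => ?_⟩
  obtain ⟨r, hr, hrh⟩ := H (-x)
  obtain ⟨t, ht, hgood⟩ := exists_mem_Icc_not_mem (hrh x) (δ := 2 * η) (by positivity)
    (by linarith) x
  simp only [mem_ofPred_eq, not_and, not_le] at hgood
  have h1 := hgood ⟨ht.1, by linarith [ht.2]⟩
  have h2 := hC (t + r) ⟨by linarith [ht.1, hr.1], by linarith [ht.2, hr.2]⟩
  rw [Real.norm_eq_abs, abs_div, div_le_iff₀ (hm.trans_le (hψ _))] at h2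
  have h3 : |h (t + r)| ≤ M * max C 0 := by
    calc |h (t + r)| ≤ C * |ψ (t + r)| := h2
      _ ≤ max C 0 * |ψ (t + r)| := by gcongr; exact le_max_left _ _
      _ ≤ max C 0 * M := by gcongr; exact hψM _
      _ = M * max C 0 := mul_comm _ _
  have h4 : |h t| ≤ M * max C 0 + 1 := by
    have := abs_sub_abs_le_abs_sub (h t) (h (t + r))
    rw [abs_sub_comm] at this
    linarith
  have h5 : |h t / ψ t| ≤ (M * max C 0 + 1) / m := by
    rw [abs_div]
    gcongr
    exact hψ t
  have h6 := hu (a := x) (b := t) (by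
    rw [Real.dist_eq, abs_sub_comm, abs_of_nonneg (by linarith [ht.1])]
    linarith [ht.2])
  rw [Real.dist_eq] at h6
  linarith [abs_sub_abs_le_abs_sub (h x / ψ x) (h t / ψ t)]

/-- The quotient of a p.c.a.p. function by a p.c.a.p. step function that is bounded away from `0`
is Bohr almost periodic as soon as it is continuous. -/
theorem PCAPAlong.bohrAP_div (hσ : PCAPAlong σ h) (hρ : PCAPAlong ρ ψ)
    (hconst : ∀ n, ∀ s ∈ Ioc (ρ n) (ρ (n + 1)), ∀ t ∈ Ioc (ρ n) (ρ (n + 1)), ψ s = ψ t)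
    (hm : 0 < m) (hψ : ∀ t, m ≤ |ψ t|) (hM : 0 < M) (hψM : ∀ t, |ψ t| ≤ M)
    (hf : Continuous fun t => h t / ψ t) : BohrAP fun t => h t / ψ t := by
  refine ⟨hf, fun ε hε => ?_⟩
  have hu := hσ.uniformContinuous_div hρ hconst hm hψ hf
  obtain ⟨C, hC, hbd⟩ := hσ.exists_bound_div hm hψ hM hψM hu
  obtain ⟨δ, hδ, hu⟩ := Metric.uniformContinuous_iff.1 hu (ε / 3) (by positivity)
  have hq : 0 < ε / 3 * m / (1 + C) := by positivity
  -- The two exceptional sets have total measure at most `2 * η`, so a good point lies within `3 * η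
  -- < δ` of `x`; the second bound keeps the quotient error below `ε / 3`.
  set η := min (min δ 1 / 6) (ε / 3 * m / (1 + C)) with hη
  have hη0 : 0 < η := by positivity
  have hη1 : η ≤ min δ 1 / 6 := min_le_left _ _
  have hη2 : η * (1 + C) ≤ ε / 3 * m := (le_div_iff₀ (by positivity)).1 (min_le_right _ _)
  have hd1 := min_le_left δ 1
  have hd2 := min_le_right δ 1
  refine (hσ.isPeriodFamily.relativelyDense_inter hρ.isPeriodFamily hη0).mono ?_
  rintro r ⟨hr, hr'⟩ x
  have hvol := (MeasureTheory.measure_union_le _ _).trans (add_le_add (hr x) (hr' x))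
  rw [← ENNReal.ofReal_add hη0.le hη0.le] at hvol
  obtain ⟨t, ht, hgood⟩ := exists_mem_Icc_not_mem hvol (δ := 3 * η) (by positivity)
    (by linarith) x
  have htx : t ∈ Icc x (x + 1) := ⟨ht.1, by linarith [ht.2]⟩
  simp only [mem_union, mem_ofPred_eq, not_or, not_and, not_le] at hgood
  have h1 := hgood.1 htx
  have h2 := hgood.2 htx
  have h3 : |h (t + r) / ψ (t + r) - h t / ψ t| < ε / 3 := by
    refine (abs_div_sub_div_le hm (hψ _) (hψ _)).trans_lt ?_
    rw [div_lt_iff₀ hm]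
    have : |h t / ψ t| * |ψ (t + r) - ψ t| ≤ C * η := mul_le_mul (hbd t) h2.le (abs_nonneg _) hC.le
    linarith
  have hdist : |x - t| < δ := by
    rw [abs_sub_comm, abs_of_nonneg (by linarith [ht.1])]
    linarith [ht.2]
  have h4 := hu (a := x) (b := t) hdist
  have h5 := hu (a := x + r) (b := t + r) (by
    rwa [Real.dist_eq, add_sub_add_right_eq_sub])
  rw [Real.dist_eq, abs_lt] at h4 h5
  rw [abs_lt] at *
  constructor <;> linarith [h3.1, h3.2, h4.1, h4.2, h5.1, h5.2]

end Quotient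

/-! ### From the quotient back to p.c.a.p. functions. -/

/-- A function whose quotient by the step function is Bohr almost periodic is p.c.a.p. -/
theorem Regular.isPCAP_of_div {b : ℤ → ℝ} {h : ℝ → ℝ} (hb : Regular b) (ha : Admissible τ)
    (hτ : EquipotentiallyAP τ) (hpc : IsPCAlong τ h)
    (hf : BohrAP fun t => h t / stepFun τ b t) : IsPCAP h := by
  obtain ⟨m, M, hm, hM, hψ⟩ := hb.stepFun_bounds τ
  have hmul : ∀ t, h t = h t / stepFun τ b t * stepFun τ b t := fun t =>
    (div_mul_cancel₀ _ (abs_pos.1 (hm.trans_le (hψ t).1))).symm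
  refine ⟨⟨τ, ha, hpc⟩, τ, ha, hpc.1, hτ, fun ε hε => ?_, fun ε hε => ?_⟩
  · obtain ⟨δ, hδ, hu⟩ := Metric.uniformContinuous_iff.1 hf.uniformContinuous (ε / M)
      (by positivity)
    refine ⟨δ, hδ, fun j s hs t ht hd => ?_⟩
    have h1 := hu (a := s) (b := t) hd
    rw [Real.dist_eq, lt_div_iff₀ hM] at h1
    have e : stepFun τ b s = stepFun τ b t := by
      rw [stepFun_eq ha b hs.1 hs.2, stepFun_eq ha b ht.1 ht.2]
    rw [hmul s, hmul t, e, ← sub_mul, abs_mul]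
    rw [e] at h1
    exact (mul_le_mul_of_nonneg_left (hψ t).2 (abs_nonneg _)).trans_lt h1
  · obtain ⟨C, hC, hbd⟩ := hf.exists_bound
    have hq : 0 < ε / (M + C) := by positivity
    -- `η ≤ ε` makes points `ε`-far from `τ` also `η`-far; `η * (M + C) ≤ ε` absorbs both terms of
    -- the product rule.
    set η := min ε (ε / (M + C)) with hη
    have hη0 : 0 < η := by positivity
    have hη1 : η * (M + C) ≤ ε := (le_div_iff₀ (by positivity)).1 (min_le_right _ _)
    refine (hf.isPeriodFamily.relativelyDense_inter
      (isPeriodFamily_stepPeriods ha hτ hb.bohrAP_multSeq) hη0).mono ?_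
    rintro r ⟨hr, hr'⟩ t hfar
    have h1 := hr t
    have h2 := stepFun_sub_lt ha hr' fun j => (min_le_left _ _).trans_lt (hfar j)
    have h3 := hbd t
    have h4 := (hψ (t + r)).2
    have e : h (t + r) - h t =
        (h (t + r) / stepFun τ b (t + r) - h t / stepFun τ b t) * stepFun τ b (t + r) +
          h t / stepFun τ b t * (stepFun τ b (t + r) - stepFun τ b t) := by
      nth_rewrite 1 [hmul (t + r)]
      nth_rewrite 1 [hmul t]
      ring
    rw [e]
    calc _ ≤ _ := abs_add_le _ _
      _ < η * M + C * η := by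
        rw [abs_mul, abs_mul]
        refine add_lt_add_of_lt_of_le ?_ (mul_le_mul h3 h2.le (abs_nonneg _) hC.le)
        exact (mul_le_mul_of_nonneg_left h4 (abs_nonneg _)).trans_lt (mul_lt_mul_of_pos_right h1 hM)
      _ = η * (M + C) := by ring
      _ ≤ ε := hη1

end ImpulsiveAP

theorem theorem3 (d : ℕ) (g : Fin d → (Fin d → ℝ) → ℝ → ℝ)
    (hg : ∀ i, Continuous (fun p : (Fin d → ℝ) × ℝ => g i p.1 p.2))
    (τ : ℤ → ℝ) (hτ : IsWexler τ)
    (b : Fin d → ℤ → ℝ) (hb : ∀ i, Regular (b i)) :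
    (∀ φ : Fin d → ℝ → ℝ,
      IsImpulsiveSolution g τ b φ → (∀ i, IsPCAP (φ i)) → (∀ i n, φ i (τ n) ≠ 0) →
        IsTransformedSolution g τ b (fun i t => φ i t / stepFun τ (b i) t) ∧
        ∀ i, BohrAP (fun t => φ i t / stepFun τ (b i) t)) ∧
    (∀ φ : Fin d → ℝ → ℝ,
      IsTransformedSolution g τ b (fun i t => φ i t / stepFun τ (b i) t) →
      (∀ i, BohrAP (fun t => φ i t / stepFun τ (b i) t)) →
        IsImpulsiveSolution g τ b φ ∧ ∀ i, IsPCAP (φ i)) := by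
  have ha := hτ.1
  have he := hτ.2.2
  have hne : ∀ i n, 1 + b i n ≠ 0 := fun i => (hb i).ne_zero
  have hψ : ∀ i t, stepFun τ (b i) t ≠ 0 := fun i t => by
    obtain ⟨m, M, hm, -, h⟩ := (hb i).stepFun_bounds τ
    exact abs_pos.1 (hm.trans_le (h t).1)
  refine ⟨fun φ hφ hpc _ => ⟨hφ.isTransformedSolution ha hne hψ, fun i => ?_⟩,
    fun φ hφ hap => ?_⟩
  · obtain ⟨m, M, hm, hM, h⟩ := (hb i).stepFun_bounds τ
    obtain ⟨σ, hσ⟩ := (hpc i).exists_pcapAlong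
    exact hσ.bohrAP_div ((hb i).pcapAlong_stepFun ha he)
      (fun n s hs t ht => by rw [stepFun_eq ha _ hs.1 hs.2, stepFun_eq ha _ ht.1 ht.2])
      hm (fun t => (h t).1) hM (fun t => (h t).2) (hφ.continuous_div ha hne hψ i)
  · have hsol := hφ.isImpulsiveSolution ha hne hψ
    exact ⟨hsol, fun i => (hb i).isPCAP_of_div ha he
      ⟨fun t ht => ((hsol i).1 t ht).continuousAt, fun n => ⟨((hsol i).2 n).1, _, ((hsol i).2 n).2⟩⟩
      (hap i)⟩
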